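/- Let $\mathcal K$ be a (strict) 2-category with comma objects: for all $f:A\to C$ and $g:B\to C$ there are $p:P\to A$, $q:P\to B$ and a 2-cell $\lambda:fp\to gq$ such that for every $X$, pasting with $\lambda$ is an isomorphism from the category $\mathcal K(X,P)$ to the comma category $\mathcal K(X,f)\downarrow\mathcal K(X,g)$. A 2-cell $\psi:h\to lf$ (with $f:A\to C$, $h:A\to V$, $l:C\to V$) exhibits $l$ as a *left Kan extension* of $h$ along $f$ if for every $k:C\to V$ and every $\sigma:h\to kf$ there is a unique $\tau:l\to k$ with $(\tau f)\psi=\sigma$; it exhibits $l$ as a *pointwise left Kan extension* if for every $g:B\to C$ and comma square $\lambda:fp\to gq$ as above, $(l\lambda)(\psi p)$ exhibits $lg$ as a left Kan extension of $hp$ along $q$. A lax square $\phi:fp\to gq$ (with $p:P\to A$, $q:P\to B$, $f:A\to C$, $g:B\to C$) is *exact* if whenever $\psi:h\to lf$ exhibits $l$ as a pointwise left Kan extension of $h$ along $f$, the 2-cell $(l\phi)(\psi p)$ exhibits $lg$ as a pointwise left Kan extension of $hp$ along $q$. Let $T$ be a 2-monad on $\mathcal K$, that is, a 2-functor $T:\mathcal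 K\to\mathcal K$ with 2-natural transformations $\eta:1\to T$, $\mu:T^2\to T$ satisfying the monad equations strictly. A *pseudo $T$-algebra* is an object $A$ with a 1-cell $a:TA\to A$ and invertible 2-cells $a_0:1_A\to a\eta_A$, $a_2:a\,T(a)\to a\mu_A$ such that $(a_2\eta_{TA})(a_0a)=\mathrm{id}_a$, $(a_2T(\eta_A))(aT(a_0))=\mathrm{id}_a$ and $(a_2\mu_{TA})(a_2T^2(a))=(a_2T(\mu_A))(aT(a_2))$. A *colax morphism* $(A,a)\to(B,b)$ of pseudo $T$-algebras is a 1-cell $f:A\to B$ with a 2-cell $\overline f:fa\to bT(f)$ such that $(\overline f\eta_A)(fa_0)=b_0f$ and $(\overline f\mu_A)(fa_2)=(b_2T^2(f))(bT(\overline f))(\overline fT(a))$; it is *exact* if $\overline f$, regarded as the lax square with sides $a:TA\to A$, $T(f):TA\to TB$, $f:A\to B$, $b:TB\to B$, is exact. Suppose that $T$ is *colax idempotent*, that is, $\eta T\dashv\mu$ in the 2-category of 2-functors $\mathcal K\to\mathcal K$, 2-natural transformations and modifications. Then every colax morphism of pseudo $T$-algebras is exact. -/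

import Mathlib

open CategoryTheory Bicategory

universe w v u

namespace AlgKan

/-! Conventions. A 2-category is a `Bicategory` which is `Bicategory.Strict`; its unitors and
associators are then identities (`eqToHom`s), and `⊗≫` is vertical composition of 2-cells with
these identities inserted. Composition of 1-cells is written in diagrammatic order `f ≫ g`. -/

section Kan

variable {K : Type u} [Bicategory.{w, v} K]

/-- The square
```
  P --q--> B
  |p       |g
  A --f--> C
```
with the 2-cell `lam` from `f ∘ p` to `g ∘ q` is a comma square: for every `X`, pasting with `lam`
is an isomorphism from the category of 1-cells `X ⟶ P` to the category whose objects are triples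
`(a : X ⟶ A, b : X ⟶ B, f ∘ a ⟶ g ∘ b)`. -/
structure IsComma {A B C P : K} (f : A ⟶ C) (g : B ⟶ C) (p : P ⟶ A) (q : P ⟶ B)
    (lam : p ≫ f ⟶ q ≫ g) : Prop where
  /-- bijectivity on objects -/
  existsUnique_lift : ∀ {X : K} (a : X ⟶ A) (b : X ⟶ B) (σ : a ≫ f ⟶ b ≫ g),
    ∃! x : X ⟶ P, ∃ (ha : x ≫ p = a) (hb : x ≫ q = b),
      (α_ x p f).hom ≫ x ◁ lam ≫ (α_ x q g).inv =
        eqToHom ha ▷ f ≫ σ ≫ eqToHom hb.symm ▷ g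
  /-- bijectivity on arrows -/
  existsUnique_lift₂ : ∀ {X : K} (x y : X ⟶ P) (ζ : x ≫ p ⟶ y ≫ p) (ξ : x ≫ q ⟶ y ≫ q),
    ζ ▷ f ≫ (α_ y p f).hom ≫ y ◁ lam ≫ (α_ y q g).inv =
      (α_ x p f).hom ≫ x ◁ lam ≫ (α_ x q g).inv ≫ ξ ▷ g →
    ∃! τ : x ⟶ y, τ ▷ p = ζ ∧ τ ▷ q = ξ

variable (K) in
/-- Every pair of 1-cells with common codomain has a comma object. -/
def HasCommaObjects : Prop :=
  ∀ {A B C : K} (f : A ⟶ C) (g : B ⟶ C),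
    ∃ (P : K) (p : P ⟶ A) (q : P ⟶ B) (lam : p ≫ f ⟶ q ≫ g), IsComma f g p q lam

/-- `ψ` exhibits `l` as a left Kan extension of `h` along `f`. -/
def IsLeftKan {A C V : K} (f : A ⟶ C) (h : A ⟶ V) (l : C ⟶ V) (ψ : h ⟶ f ≫ l) : Prop :=
  Nonempty (LeftExtension.mk l ψ).IsKan

/-- Given a square with a 2-cell `φ` from `f ∘ p` to `g ∘ q`, and `ψ` from `h` to `l ∘ f`, the
pasted 2-cell from `h ∘ p` to `(l ∘ g) ∘ q`. -/
def paste {A B C P V : K} {f : A ⟶ C} {g : B ⟶ C} {p : P ⟶ A} {q : P ⟶ B}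
    (φ : p ≫ f ⟶ q ≫ g) {h : A ⟶ V} {l : C ⟶ V} (ψ : h ⟶ f ≫ l) : p ≫ h ⟶ q ≫ g ≫ l :=
  p ◁ ψ ≫ (α_ p f l).inv ≫ φ ▷ l ≫ (α_ q g l).hom

/-- `ψ` exhibits `l` as a pointwise left Kan extension of `h` along `f` (Street): for every `g`
into the codomain of `f`, pasting `ψ` with the comma square of `f` and `g` gives a left Kan
extension. -/
def IsPointwiseLeftKan {A C V : K} (f : A ⟶ C) (h : A ⟶ V) (l : C ⟶ V) (ψ : h ⟶ f ≫ l) : Prop :=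
  ∀ {B P : K} (g : B ⟶ C) (p : P ⟶ A) (q : P ⟶ B) (lam : p ≫ f ⟶ q ≫ g),
    IsComma f g p q lam → IsLeftKan q (p ≫ h) (g ≫ l) (paste lam ψ)

/-- A lax square is exact when pasting with it preserves pointwise left Kan extensions. -/
def IsExactSquare {A B C P : K} (f : A ⟶ C) (g : B ⟶ C) (p : P ⟶ A) (q : P ⟶ B)
    (φ : p ≫ f ⟶ q ≫ g) : Prop :=
  ∀ {V : K} (h : A ⟶ V) (l : C ⟶ V) (ψ : h ⟶ f ≫ l),
    IsPointwiseLeftKan f h l ψ → IsPointwiseLeftKan q (p ≫ h) (g ≫ l) (paste φ ψ)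

end Kan

variable (K : Type u) [Bicategory.{w, v} K]

/-- A 2-monad on `K`: a 2-functor `T` with 2-natural transformations `η : 1 ⟶ T` and
`μ : T² ⟶ T` satisfying the monad equations. -/
structure TwoMonad where
  T : StrictPseudofunctor K K
  η : ∀ A : K, A ⟶ T.obj A
  η_naturality : ∀ {A B : K} (f : A ⟶ B), f ≫ η B = η A ≫ T.map f
  η_naturality₂ : ∀ {A B : K} {f g : A ⟶ B} (θ : f ⟶ g),
    θ ▷ η B ≫ eqToHom (η_naturality g) = eqToHom (η_naturality f) ≫ η A ◁ T.map₂ θ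
  μ : ∀ A : K, T.obj (T.obj A) ⟶ T.obj A
  μ_naturality : ∀ {A B : K} (f : A ⟶ B), T.map (T.map f) ≫ μ B = μ A ≫ T.map f
  μ_naturality₂ : ∀ {A B : K} {f g : A ⟶ B} (θ : f ⟶ g),
    T.map₂ (T.map₂ θ) ▷ μ B ≫ eqToHom (μ_naturality g) =
      eqToHom (μ_naturality f) ≫ μ A ◁ T.map₂ θ
  η_T_μ : ∀ A : K, η (T.obj A) ≫ μ A = 𝟙 (T.obj A)
  T_η_μ : ∀ A : K, T.map (η A) ≫ μ A = 𝟙 (T.obj A)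
  assoc : ∀ A : K, T.map (μ A) ≫ μ A = μ (T.obj A) ≫ μ A

namespace TwoMonad

variable {K}

/-- `ηT ⊣ μ` in the 2-category of 2-functors `K ⟶ K`, 2-natural transformations and
modifications: adjunctions `η (T A) ⊣ μ A` in `K` whose units and counits are the components of
modifications `1_T ⟶ μ ∘ ηT` and `ηT ∘ μ ⟶ 1_{T²}`. -/
def IsColaxIdempotent (M : TwoMonad K) : Prop :=
  ∃ adj : ∀ A : K, M.η (M.T.obj A) ⊣ M.μ A,
    (∀ {A B : K} (f : A ⟶ B),
      𝟙 (M.T.map f) ⊗≫ (adj A).unit ▷ M.T.map f ⊗≫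
          M.η (M.T.obj A) ◁ eqToHom (M.μ_naturality f).symm =
        𝟙 (M.T.map f) ⊗≫ M.T.map f ◁ (adj B).unit ⊗≫
          eqToHom (M.η_naturality (M.T.map f)) ▷ M.μ B ⊗≫
          𝟙 (M.η (M.T.obj A) ≫ M.T.map (M.T.map f) ≫ M.μ B)) ∧
    (∀ {A B : K} (f : A ⟶ B),
      𝟙 (M.μ A ≫ M.η (M.T.obj A) ≫ M.T.map (M.T.map f)) ⊗≫
          (adj A).counit ▷ M.T.map (M.T.map f) ⊗≫ 𝟙 (M.T.map (M.T.map f)) =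
        M.μ A ◁ eqToHom (M.η_naturality (M.T.map f)).symm ⊗≫
          eqToHom (M.μ_naturality f).symm ▷ M.η (M.T.obj B) ⊗≫
          M.T.map (M.T.map f) ◁ (adj B).counit ⊗≫ 𝟙 (M.T.map (M.T.map f)))

/-- A pseudo algebra of a 2-monad. -/
structure PseudoAlgebra (M : TwoMonad K) where
  A : K
  a : M.T.obj A ⟶ A
  a₀ : 𝟙 A ≅ M.η A ≫ a
  a₂ : M.T.map a ≫ a ≅ M.μ A ≫ a
  left_unit :
    𝟙 a ⊗≫ a ◁ a₀.hom ⊗≫ eqToHom (M.η_naturality a) ▷ a ⊗≫ M.η (M.T.obj A) ◁ a₂.hom ⊗≫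
      eqToHom (M.η_T_μ A) ▷ a ⊗≫ 𝟙 a = 𝟙 a
  right_unit :
    𝟙 a ⊗≫ (M.T.mapId A).inv ▷ a ≫ M.T.map₂ a₀.hom ▷ a ≫ (M.T.mapComp (M.η A) a).hom ▷ a ⊗≫
      M.T.map (M.η A) ◁ a₂.hom ⊗≫ eqToHom (M.T_η_μ A) ▷ a ⊗≫ 𝟙 a = 𝟙 a
  associativity :
    M.T.map (M.T.map a) ◁ a₂.hom ⊗≫ eqToHom (M.μ_naturality a) ▷ a ⊗≫
        M.μ (M.T.obj A) ◁ a₂.hom ⊗≫ 𝟙 ((M.μ (M.T.obj A) ≫ M.μ A) ≫ a) =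
      𝟙 (M.T.map (M.T.map a) ≫ M.T.map a ≫ a) ⊗≫
        (M.T.mapComp (M.T.map a) a).inv ▷ a ≫ M.T.map₂ a₂.hom ▷ a ≫
        (M.T.mapComp (M.μ A) a).hom ▷ a ⊗≫ M.T.map (M.μ A) ◁ a₂.hom ⊗≫
        eqToHom (M.assoc A) ▷ a

/-- A colax morphism of pseudo algebras. -/
structure ColaxMorphism {M : TwoMonad K} (X Y : PseudoAlgebra M) where
  f : X.A ⟶ Y.A
  fbar : X.a ≫ f ⟶ M.T.map f ≫ Y.a
  unit :
    𝟙 f ⊗≫ X.a₀.hom ▷ f ⊗≫ M.η X.A ◁ fbar =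
      𝟙 f ⊗≫ f ◁ Y.a₀.hom ⊗≫ eqToHom (M.η_naturality f) ▷ Y.a ⊗≫
        𝟙 (M.η X.A ≫ M.T.map f ≫ Y.a)
  structure_axiom :
    X.a₂.hom ▷ f ⊗≫ M.μ X.A ◁ fbar ⊗≫ eqToHom (M.μ_naturality f).symm ▷ Y.a =
      𝟙 ((M.T.map X.a ≫ X.a) ≫ f) ⊗≫ M.T.map X.a ◁ fbar ⊗≫
        (M.T.mapComp X.a f).inv ▷ Y.a ≫ M.T.map₂ fbar ▷ Y.a ≫
        (M.T.mapComp (M.T.map f) Y.a).hom ▷ Y.a ⊗≫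
        M.T.map (M.T.map f) ◁ Y.a₂.hom ⊗≫ 𝟙 ((M.T.map (M.T.map f) ≫ M.μ Y.A) ≫ Y.a)

/-- A colax morphism is exact when the lax square formed by its coherence 2-cell is exact. -/
def ColaxMorphism.IsExact {M : TwoMonad K} {X Y : PseudoAlgebra M} (F : ColaxMorphism X Y) :
    Prop :=
  IsExactSquare F.f Y.a X.a (M.T.map F.f) F.fbar

end TwoMonad

end AlgKan

/-
For a pseudo algebra `(A, a)`, the structure map `a` is right adjoint to `η_A` with unit `a₀`: the
counit of `ηT ⊣ μ` yields a candidate counit for which both zigzags are invertible, and this is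
enough to correct it. The unit axiom then says that the 2-cell of a colax morphism is the mate of
the identity `f ≫ η_B = η_A ≫ T f`. Such mates are exact: for `e : f ≫ L' ≅ L ≫ t` with `L ⊣ R` and
`L' ⊣ R'`, a pointwise extension along `f` gives one along `f ≫ L'`, because comma squares transpose
along `L' ⊣ R'`; hence one along `L ≫ t`, and finally one along `t`, because `L ⊣ R` lifts to the
comma objects of `L ≫ t` and of `t` with any `g`.
-/

namespace AlgKan

variable {K : Type u} [Bicategory.{w, v} K]

section Comma

variable {A B C C' P : K} {f : A ⟶ C} {g : B ⟶ C} {p : P ⟶ A} {q : P ⟶ B}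

theorem IsComma.exists_lift {lam : p ≫ f ⟶ q ≫ g} (H : IsComma f g p q lam) {X : K}
    (a : X ⟶ A) (b : X ⟶ B) (σ : a ≫ f ⟶ b ≫ g) :
    ∃ (x : X ⟶ P) (α : x ≫ p ≅ a) (β : x ≫ q ≅ b),
      (α_ x p f).hom ≫ x ◁ lam ≫ (α_ x q g).inv = α.hom ▷ f ≫ σ ≫ β.inv ▷ g := by
  obtain ⟨x, ⟨ha, hb, hx⟩, -⟩ := H.existsUnique_lift a b σ
  exact ⟨x, eqToIso ha, eqToIso hb, by simpa using hx⟩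

theorem IsComma.of_natural_equiv {f' : A ⟶ C'} {g' : B ⟶ C'} {lam : p ≫ f ⟶ q ≫ g}
    {lam' : p ≫ f' ⟶ q ≫ g'} (H : IsComma f g p q lam)
    (Φ : ∀ {X : K} (a : X ⟶ A) (b : X ⟶ B), (a ≫ f ⟶ b ≫ g) ≃ (a ≫ f' ⟶ b ≫ g'))
    (hΦ : ∀ {X : K} {a a' : X ⟶ A} {b b' : X ⟶ B} (ζ : a' ⟶ a) (σ : a ≫ f ⟶ b ≫ g)
      (ξ : b ⟶ b'), Φ a' b' (ζ ▷ f ≫ σ ≫ ξ ▷ g) = ζ ▷ f' ≫ Φ a b σ ≫ ξ ▷ g')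
    (hlam : ∀ {X : K} (x : X ⟶ P),
      Φ (x ≫ p) (x ≫ q) ((α_ x p f).hom ≫ x ◁ lam ≫ (α_ x q g).inv) =
        (α_ x p f').hom ≫ x ◁ lam' ≫ (α_ x q g').inv) :
    IsComma f' g' p q lam' where
  existsUnique_lift a b σ := by
    obtain ⟨σ, rfl⟩ := (Φ a b).surjective σ
    simpa only [← hlam, ← hΦ, (Φ _ _).apply_eq_iff_eq] using H.existsUnique_lift a b σ
  existsUnique_lift₂ x y ζ ξ h := by
    refine H.existsUnique_lift₂ x y ζ ξ ((Φ _ _).injective ?_)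
    have hl := hΦ ζ ((α_ y p f).hom ≫ y ◁ lam ≫ (α_ y q g).inv) (𝟙 _)
    have hr := hΦ (𝟙 _) ((α_ x p f).hom ≫ x ◁ lam ≫ (α_ x q g).inv) ξ
    simp only [hlam, id_whiskerRight, Category.id_comp, Category.comp_id, Category.assoc]
      at hl hr
    rw [hl, hr, h]

theorem IsComma.of_iso {f' : A ⟶ C} {lam : p ≫ f ⟶ q ≫ g} (H : IsComma f g p q lam)
    (e : f ≅ f') : IsComma f' g p q (p ◁ e.inv ≫ lam) :=
  H.of_natural_equiv (fun a b => (whiskerLeftIso a e).homCongr (Iso.refl (b ≫ g)))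
    (fun ζ σ ξ => by simp [← whisker_exchange_assoc]) (fun x => by simp)

theorem IsComma.transpose {L : C ⟶ C'} {R : C' ⟶ C} {y : B ⟶ C'} {lam : p ≫ f ≫ L ⟶ q ≫ y}
    (H : IsComma (f ≫ L) y p q lam) (adj : L ⊣ R) :
    IsComma f (y ≫ R) p q (adj.homEquiv₂ ((α_ p f L).hom ≫ lam) ≫ (α_ q y R).hom) :=
  H.of_natural_equiv
    (fun a b => ((α_ a f L).symm.homCongr (Iso.refl (b ≫ y))).trans
      (adj.homEquiv₂.trans ((Iso.refl (a ≫ f)).homCongr (α_ b y R))))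
    (fun {_ a a' b b'} ζ σ ξ => by
      simp only [Equiv.trans_apply, Iso.homCongr_apply, Adjunction.homEquiv₂_apply,
        Iso.symm_inv, Iso.refl_inv, Iso.refl_hom, Category.id_comp, Category.comp_id]
      calc
        _ = 𝟙 _ ⊗≫ ((a' ≫ f) ◁ adj.unit ≫ ζ ▷ f ▷ (L ≫ R)) ⊗≫ σ ▷ R ⊗≫ ξ ▷ y ▷ R ⊗≫ 𝟙 _ := by
            bicategory
        _ = _ := by
            rw [whisker_exchange]; bicategory)
    (fun x => by
      simp only [Equiv.trans_apply, Iso.homCongr_apply, Adjunction.homEquiv₂_apply,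
        Iso.symm_inv, Iso.refl_inv, Iso.refl_hom, Category.id_comp, Category.comp_id]
      bicategory)

end Comma

theorem isLeftKan_iff {A C V : K} {f : A ⟶ C} {h : A ⟶ V} {l : C ⟶ V} {ψ : h ⟶ f ≫ l} :
    IsLeftKan f h l ψ ↔
      ∀ (k : C ⟶ V) (σ : h ⟶ f ≫ k), ∃! τ : l ⟶ k, ψ ≫ f ◁ τ = σ := by
  constructor
  · rintro ⟨H⟩ k σ
    refine ⟨H.desc (LeftExtension.mk k σ), H.fac (LeftExtension.mk k σ), fun τ hτ => ?_⟩
    exact H.hom_ext (hτ.trans (H.fac (LeftExtension.mk k σ)).symm)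
  · intro H
    choose d hd hu using H
    exact ⟨LeftExtension.IsKan.mk (fun s => LeftExtension.homMk (d s.extension s.unit) (hd _ _))
      fun s τ => by
        ext
        exact hu _ _ _ (LeftExtension.w τ)⟩

theorem IsLeftKan.of_iso {A C V : K} {f : A ⟶ C} {h : A ⟶ V} {l l' : C ⟶ V} {ψ : h ⟶ f ≫ l}
    (H : IsLeftKan f h l ψ) (i : l ≅ l') : IsLeftKan f h l' (ψ ≫ f ◁ i.hom) :=
  H.map fun H => H.ofIsoKan (StructuredArrow.isoMk i)

theorem comp_whiskerLeft_injective_of_retraction {A B V : K} {s : A ⟶ B} {r : B ⟶ A}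
    {h : A ⟶ V} {h' : B ⟶ V} (κ : r ≫ s ⟶ 𝟙 B) (ω : h ⟶ s ≫ h') (θ : h' ⟶ r ≫ h)
    (hω : θ ≫ r ◁ ω ≫ (α_ r s h').inv ≫ κ ▷ h' ≫ (λ_ h').hom = 𝟙 h') (x : B ⟶ V) :
    Function.Injective fun σ : h' ⟶ x => ω ≫ s ◁ σ :=
  Function.LeftInverse.injective
    (g := fun ρ => θ ≫ r ◁ ρ ≫ (α_ r s x).inv ≫ κ ▷ x ≫ (λ_ x).hom) fun σ => by
    calc
      _ = θ ≫ r ◁ ω ⊗≫ ((r ≫ s) ◁ σ ≫ κ ▷ x) ⊗≫ 𝟙 _ := by bicategory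
      _ = (θ ≫ r ◁ ω ≫ (α_ r s h').inv ≫ κ ▷ h' ≫ (λ_ h').hom) ≫ σ := by
          rw [whisker_exchange]; bicategory
      _ = σ := by rw [hω, Category.id_comp]

theorem IsLeftKan.of_restrict {P P' Z V : K} {q : P ⟶ Z} {q' : P' ⟶ Z} {h : P ⟶ V}
    {h' : P' ⟶ V} {l : Z ⟶ V} {ψ' : h' ⟶ q' ≫ l} {s : P ⟶ P'} {ω : h ⟶ s ≫ h'}
    (e : s ≫ q' ≅ q) (H : IsLeftKan q h l (ω ≫ s ◁ ψ' ≫ (α_ s q' l).inv ≫ e.hom ▷ l))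
    (hω : ∀ x : P' ⟶ V, Function.Injective fun σ : h' ⟶ x => ω ≫ s ◁ σ) :
    IsLeftKan q' h' l ψ' := by
  rw [isLeftKan_iff] at H ⊢
  have restrict_comp {k : Z ⟶ V} (τ : l ⟶ k) :
      (ω ≫ s ◁ ψ' ≫ (α_ s q' l).inv ≫ e.hom ▷ l) ≫ q ◁ τ =
        (ω ≫ s ◁ (ψ' ≫ q' ◁ τ)) ≫ (α_ s q' k).inv ≫ e.hom ▷ k := by
    simp [← whisker_exchange]
  intro k σ
  obtain ⟨τ, hτ, hτ_unique⟩ := H k ((ω ≫ s ◁ σ) ≫ (α_ s q' k).inv ≫ e.hom ▷ k)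
  refine ⟨τ, hω _ ?_, fun τ' hτ' => hτ_unique τ' ?_⟩
  · simpa only [restrict_comp, cancel_mono] using hτ
  · simp only [restrict_comp, hτ']

theorem IsPointwiseLeftKan.of_iso {A C V : K} {f f' : A ⟶ C} {h : A ⟶ V} {l : C ⟶ V}
    {ψ : h ⟶ f ≫ l} (H : IsPointwiseLeftKan f h l ψ) (e : f ≅ f') :
    IsPointwiseLeftKan f' h l (ψ ≫ e.hom ▷ l) := by
  intro B P g p q lam hlam
  convert H g p q _ (hlam.of_iso e.symm) using 1
  simp [paste]

theorem IsPointwiseLeftKan.comp_leftAdjoint {A C C' V : K} {f : A ⟶ C} {h : A ⟶ V} {l : C ⟶ V}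
    {ψ : h ⟶ f ≫ l} (H : IsPointwiseLeftKan f h l ψ) {L : C ⟶ C'} {R : C' ⟶ C} (adj : L ⊣ R) :
    IsPointwiseLeftKan (f ≫ L) h (R ≫ l) (ψ ⊗≫ f ◁ adj.unit ▷ l ⊗≫ 𝟙 ((f ≫ L) ≫ R ≫ l)) := by
  intro B P y p q lam hlam
  convert (H (y ≫ R) p q _ (hlam.transpose adj)).of_iso (α_ y R l) using 1
  simp only [paste, Adjunction.homEquiv₂_apply]
  bicategory

section Adjunction

variable {A A' : K} {L : A ⟶ A'} {R : A' ⟶ A}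

-- `s` and `r` are induced by the cones `(p ≫ L, q)` and `(p' ≫ R, q')`; the 2-cell `κ`, which lies
-- over `adj.counit`, is the counit of an adjunction `s ⊣ r`.
theorem IsComma.exists_comparison (adj : L ⊣ R) {B C P P' : K} {t : A' ⟶ C} {g : B ⟶ C}
    {p : P ⟶ A} {q : P ⟶ B} {lam : p ≫ L ≫ t ⟶ q ≫ g} (H : IsComma (L ≫ t) g p q lam)
    {p' : P' ⟶ A'} {q' : P' ⟶ B} {lam' : p' ≫ t ⟶ q' ≫ g} (H' : IsComma t g p' q' lam') :
    ∃ (s : P ⟶ P') (r : P' ⟶ P) (α : s ≫ p' ≅ p ≫ L) (β : s ≫ q' ≅ q) (γ : r ≫ p ≅ p' ≫ R)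
      (κ : r ≫ s ⟶ 𝟙 P'),
      s ◁ lam' = 𝟙 _ ⊗≫ α.hom ▷ t ⊗≫ lam ⊗≫ β.inv ▷ g ⊗≫ 𝟙 _ ∧
      κ ▷ p' = 𝟙 _ ⊗≫ r ◁ α.hom ⊗≫ γ.hom ▷ L ⊗≫ p' ◁ adj.counit ⊗≫ 𝟙 _ := by
  obtain ⟨s, α, β, hs⟩ := H'.exists_lift (p ≫ L) q ((α_ p L t).hom ≫ lam)
  obtain ⟨r, γ, δ, hr⟩ := H.exists_lift (p' ≫ R) q'
    (𝟙 _ ⊗≫ p' ◁ adj.counit ▷ t ⊗≫ lam')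
  have hs' : s ◁ lam' = 𝟙 _ ⊗≫ α.hom ▷ t ⊗≫ lam ⊗≫ β.inv ▷ g ⊗≫ 𝟙 _ := by
    calc
      _ = 𝟙 _ ⊗≫ ((α_ s p' t).hom ≫ s ◁ lam' ≫ (α_ s q' g).inv) ⊗≫ 𝟙 _ := by bicategory
      _ = _ := by rw [hs]; bicategory
  have hr' : r ◁ lam = 𝟙 _ ⊗≫ γ.hom ▷ (L ≫ t) ⊗≫ p' ◁ adj.counit ▷ t ⊗≫ lam' ⊗≫
      δ.inv ▷ g ⊗≫ 𝟙 _ := by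
    calc
      _ = 𝟙 _ ⊗≫ ((α_ r p (L ≫ t)).hom ≫ r ◁ lam ≫ (α_ r q g).inv) ⊗≫ 𝟙 _ := by bicategory
      _ = _ := by rw [hr]; bicategory
  obtain ⟨κ, ⟨hκ, -⟩, -⟩ := H'.existsUnique_lift₂ (r ≫ s) (𝟙 P')
    (𝟙 _ ⊗≫ r ◁ α.hom ⊗≫ γ.hom ▷ L ⊗≫ p' ◁ adj.counit ⊗≫ 𝟙 _)
    ((α_ _ _ _).hom ≫ r ◁ β.hom ≫ δ.hom ≫ (λ_ _).inv) (by
      symm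
      calc
        _ = 𝟙 _ ⊗≫ r ◁ s ◁ lam' ⊗≫ r ◁ β.hom ▷ g ⊗≫ δ.hom ▷ g ⊗≫ 𝟙 _ := by bicategory
        _ = 𝟙 _ ⊗≫ r ◁ α.hom ▷ t ⊗≫ r ◁ lam ⊗≫ r ◁ (β.inv ≫ β.hom) ▷ g ⊗≫ δ.hom ▷ g ⊗≫ 𝟙 _ := by
            rw [hs']; bicategory
        _ = 𝟙 _ ⊗≫ r ◁ α.hom ▷ t ⊗≫ γ.hom ▷ (L ≫ t) ⊗≫ p' ◁ adj.counit ▷ t ⊗≫ lam' ⊗≫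
              (δ.inv ≫ δ.hom) ▷ g ⊗≫ 𝟙 _ := by
            rw [hr', β.inv_hom_id]; bicategory
        _ = _ := by rw [δ.inv_hom_id]; bicategory)
  exact ⟨s, r, α, β, γ, κ, hs', hκ⟩

theorem whiskerLeft_comparison_injective (adj : L ⊣ R) {P P' V : K} {p : P ⟶ A} {p' : P' ⟶ A'}
    {s : P ⟶ P'} {r : P' ⟶ P} (α : s ≫ p' ≅ p ≫ L) (γ : r ≫ p ≅ p' ≫ R) (κ : r ≫ s ⟶ 𝟙 P')
    (hκ : κ ▷ p' = 𝟙 _ ⊗≫ r ◁ α.hom ⊗≫ γ.hom ▷ L ⊗≫ p' ◁ adj.counit ⊗≫ 𝟙 _)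
    (h : A ⟶ V) (x : P' ⟶ V) :
    Function.Injective fun σ : p' ≫ R ≫ h ⟶ x =>
      (𝟙 (p ≫ h) ⊗≫ p ◁ adj.unit ▷ h ⊗≫ α.inv ▷ (R ≫ h) ⊗≫ 𝟙 (s ≫ p' ≫ R ≫ h)) ≫ s ◁ σ := by
  refine comp_whiskerLeft_injective_of_retraction κ _
    ((α_ p' R h).inv ≫ γ.inv ▷ h ≫ (α_ r p h).hom) ?_ x
  have right_triangle : R ◁ adj.unit ⊗≫ adj.counit ▷ R = _ := adj.right_triangle
  calc
    _ = 𝟙 _ ⊗≫ γ.inv ▷ h ⊗≫ r ◁ p ◁ adj.unit ▷ h ⊗≫ r ◁ α.inv ▷ (R ≫ h) ⊗≫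
          (κ ▷ p') ▷ (R ≫ h) ⊗≫ 𝟙 _ := by bicategory
    _ = 𝟙 _ ⊗≫ γ.inv ▷ h ⊗≫ r ◁ p ◁ adj.unit ▷ h ⊗≫ r ◁ (α.inv ≫ α.hom) ▷ (R ≫ h) ⊗≫
          γ.hom ▷ (L ≫ R ≫ h) ⊗≫ p' ◁ adj.counit ▷ (R ≫ h) ⊗≫ 𝟙 _ := by
        rw [hκ]; bicategory
    _ = 𝟙 _ ⊗≫ γ.inv ▷ h ⊗≫ ((r ≫ p) ◁ adj.unit ≫ γ.hom ▷ (L ≫ R)) ▷ h ⊗≫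
          p' ◁ adj.counit ▷ (R ≫ h) ⊗≫ 𝟙 _ := by
        rw [α.inv_hom_id]; bicategory
    _ = 𝟙 _ ⊗≫ (γ.inv ≫ γ.hom) ▷ h ⊗≫ p' ◁ (R ◁ adj.unit ⊗≫ adj.counit ▷ R) ▷ h ⊗≫ 𝟙 _ := by
        rw [whisker_exchange]; bicategory
    _ = _ := by
        rw [γ.inv_hom_id, right_triangle]; bicategory

theorem IsPointwiseLeftKan.restrict_rightAdjoint (hK : HasCommaObjects K) (adj : L ⊣ R) {C V : K}
    {t : A' ⟶ C} {h : A ⟶ V} {l : C ⟶ V} {ψ : h ⟶ (L ≫ t) ≫ l}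
    (H : IsPointwiseLeftKan (L ≫ t) h l ψ) :
    IsPointwiseLeftKan t (R ≫ h) l (adj.homEquiv₁ (ψ ≫ (α_ L t l).hom)) := by
  intro B P' g p' q' lam' hlam'
  obtain ⟨P, p, q, lam, hlam⟩ := hK (L ≫ t) g
  obtain ⟨s, r, α, β, γ, κ, hs, hκ⟩ := hlam.exists_comparison adj hlam'
  refine IsLeftKan.of_restrict (ω := 𝟙 _ ⊗≫ p ◁ adj.unit ▷ h ⊗≫ α.inv ▷ (R ≫ h) ⊗≫ 𝟙 _) β ?_
    (whiskerLeft_comparison_injective adj α γ κ hκ h)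
  convert H g p q lam hlam using 1
  have left_triangle : adj.unit ▷ L ⊗≫ L ◁ adj.counit = _ := adj.left_triangle
  rw [paste, paste, Adjunction.homEquiv₁_apply]
  calc
    _ = 𝟙 _ ⊗≫ p ◁ adj.unit ▷ h ⊗≫
          (α.inv ▷ (R ≫ h) ≫ (s ≫ p') ◁ (R ◁ ψ ⊗≫ adj.counit ▷ (t ≫ l) ⊗≫ 𝟙 (t ≫ l))) ⊗≫
          (s ◁ lam') ▷ l ⊗≫ β.hom ▷ (g ≫ l) := by bicategory
    _ = 𝟙 _ ⊗≫ p ◁ (adj.unit ▷ h ≫ (L ≫ R) ◁ ψ) ⊗≫ p ◁ L ◁ adj.counit ▷ (t ≫ l) ⊗≫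
          (α.inv ≫ α.hom) ▷ (t ≫ l) ⊗≫ lam ▷ l ⊗≫ (β.inv ≫ β.hom) ▷ (g ≫ l) := by
        rw [← whisker_exchange, hs]; bicategory
    _ = 𝟙 _ ⊗≫ p ◁ ψ ⊗≫ p ◁ (adj.unit ▷ L ⊗≫ L ◁ adj.counit) ▷ (t ≫ l) ⊗≫ lam ▷ l ⊗≫ 𝟙 _ := by
        rw [← whisker_exchange, α.inv_hom_id, β.inv_hom_id]; bicategory
    _ = _ := by
        rw [left_triangle]; bicategory

variable {B B' : K} {L' : B ⟶ B'} {R' : B' ⟶ B} {f : A ⟶ B} {t : A' ⟶ B'}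

theorem isExactSquare_mateEquiv (hK : HasCommaObjects K) (adj : L ⊣ R) (adj' : L' ⊣ R')
    (e : f ≫ L' ≅ L ≫ t) : IsExactSquare f R' R t (mateEquiv adj adj' e.hom) := by
  intro V h l ψ H
  have paste_mate : paste (mateEquiv adj adj' e.hom) ψ = adj.homEquiv₁
      (((ψ ⊗≫ f ◁ adj'.unit ▷ l ⊗≫ 𝟙 ((f ≫ L') ≫ R' ≫ l)) ≫ e.hom ▷ (R' ≫ l)) ≫
        (α_ L t (R' ≫ l)).hom) := by
    rw [paste, mateEquiv_apply', Adjunction.homEquiv₁_apply]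
    bicategory
  rw [paste_mate]
  intro _ _
  exact IsPointwiseLeftKan.restrict_rightAdjoint hK adj
    (IsPointwiseLeftKan.of_iso (H.comp_leftAdjoint adj') e)

theorem eq_mateEquiv_of_unit_comp (adj : L ⊣ R) (adj' : L' ⊣ R') (e : f ≫ L' ⟶ L ≫ t)
    (φ : R ≫ f ⟶ t ≫ R')
    (hφ : 𝟙 f ⊗≫ adj.unit ▷ f ⊗≫ L ◁ φ =
      𝟙 f ⊗≫ f ◁ adj'.unit ⊗≫ e ▷ R' ⊗≫ 𝟙 (L ≫ t ≫ R')) :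
    φ = mateEquiv adj adj' e := by
  have left_triangle : adj'.unit ▷ L' ⊗≫ L' ◁ adj'.counit = _ := adj'.left_triangle
  rw [← Equiv.symm_apply_eq, mateEquiv_symm_apply']
  calc
    _ = 𝟙 _ ⊗≫ (𝟙 f ⊗≫ adj.unit ▷ f ⊗≫ L ◁ φ) ▷ L' ⊗≫ (L ≫ t) ◁ adj'.counit ⊗≫ 𝟙 _ := by
        bicategory
    _ = 𝟙 _ ⊗≫ f ◁ adj'.unit ▷ L' ⊗≫ (e ▷ (R' ≫ L') ≫ (L ≫ t) ◁ adj'.counit) ⊗≫ 𝟙 _ := by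
        rw [hφ]; bicategory
    _ = 𝟙 _ ⊗≫ f ◁ (adj'.unit ▷ L' ⊗≫ L' ◁ adj'.counit) ⊗≫ e ⊗≫ 𝟙 _ := by
        rw [← whisker_exchange]; bicategory
    _ = e := by
        rw [left_triangle]; bicategory

end Adjunction

section Unit

variable {A B : K} {L : A ⟶ B} {R : B ⟶ A}

theorem exists_adjunction_of_isIso_zigzag (u : 𝟙 A ⟶ L ≫ R) (v : R ≫ L ⟶ 𝟙 B)
    [IsIso (leftZigzag u v)] [IsIso (rightZigzag u v)] : ∃ adj : L ⊣ R, adj.unit = u := by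
  let v' : R ≫ L ⟶ 𝟙 B := R ◁ ((ρ_ L).inv ≫ inv (leftZigzag u v) ≫ (λ_ L).hom) ≫ v
  have left_triangle : leftZigzag u v' = (λ_ L).hom ≫ (ρ_ L).inv := by
    calc
      _ = 𝟙 _ ⊗≫ (u ▷ L ≫ (L ≫ R) ◁ ((ρ_ L).inv ≫ inv (leftZigzag u v) ≫ (λ_ L).hom)) ⊗≫
            L ◁ v := by bicategory
      _ = 𝟙 _ ⊗≫ (inv (leftZigzag u v) ≫ leftZigzag u v) := by
          rw [← whisker_exchange]; bicategory
      _ = _ := by rw [IsIso.inv_hom_id]; bicategory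
  have injective : Function.Injective fun σ : R ⟶ R => u ≫ L ◁ σ :=
    comp_whiskerLeft_injective_of_retraction v u ((λ_ R).inv ≫ inv (rightZigzag u v)) (by
      calc
        _ = (λ_ R).inv ≫ (inv (rightZigzag u v) ≫ rightZigzag u v) ≫ (λ_ R).hom := by bicategory
        _ = 𝟙 R := by simp only [IsIso.inv_hom_id, Category.id_comp, Iso.inv_hom_id]) R
  -- Both sides become `u` under `σ ↦ u ≫ L ◁ σ`.
  have right_triangle : (ρ_ R).inv ≫ rightZigzag u v' ≫ (λ_ R).hom = 𝟙 R := injective <| by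
    calc
      _ = 𝟙 _ ⊗≫ (u ▷ 𝟙 A ≫ (L ≫ R) ◁ u) ⊗≫ L ◁ v' ▷ R ⊗≫ 𝟙 _ := by bicategory
      _ = 𝟙 _ ⊗≫ u ⊗≫ leftZigzag u v' ▷ R ⊗≫ 𝟙 _ := by
          rw [← whisker_exchange]; bicategory
      _ = u ≫ L ◁ 𝟙 R := by rw [left_triangle]; bicategory
  exact ⟨⟨u, v', left_triangle, by
    simpa [Iso.inv_comp_eq, ← Iso.eq_comp_inv] using right_triangle⟩, rfl⟩

theorem isIso_unit_of_iso (adj : L ⊣ R) (i : L ≫ R ≅ 𝟙 A) : IsIso adj.unit := by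
  let v : L ≫ R ⟶ 𝟙 A := (ρ_ _).inv ≫ (L ≫ R) ◁ i.inv ⊗≫ L ◁ adj.counit ▷ R ⊗≫ i.hom
  have unit_v : adj.unit ≫ v = 𝟙 _ := by
    calc
      _ = 𝟙 _ ⊗≫ (adj.unit ▷ 𝟙 A ≫ (L ≫ R) ◁ i.inv) ⊗≫ L ◁ adj.counit ▷ R ⊗≫ i.hom := by
          bicategory
      _ = 𝟙 _ ⊗≫ i.inv ⊗≫ leftZigzag adj.unit adj.counit ▷ R ⊗≫ i.hom := by
          rw [← whisker_exchange]; bicategory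
      _ = 𝟙 _ ⊗≫ (i.inv ≫ i.hom) ⊗≫ 𝟙 _ := by
          rw [adj.left_triangle]; bicategory
      _ = _ := by rw [i.inv_hom_id]; bicategory
  have comm (x y : 𝟙 A ⟶ 𝟙 A) : x ≫ y = y ≫ x := by
    calc
      _ = 𝟙 _ ⊗≫ (x ▷ 𝟙 A ≫ 𝟙 A ◁ y) ⊗≫ 𝟙 _ := by bicategory
      _ = _ := by rw [← whisker_exchange]; bicategory
  refine ⟨v, unit_v, ?_⟩
  have := comm (adj.unit ≫ i.hom) (i.inv ≫ v)
  rw [Category.assoc, i.hom_inv_id_assoc, unit_v, Category.assoc] at this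
  rw [← cancel_mono i.hom, ← cancel_epi i.inv]
  simp [this]

theorem isIso_whiskerLeft_counit (adj : L ⊣ R) [IsIso adj.unit] : IsIso (L ◁ adj.counit) := by
  have left_triangle :
      (adj.unit ▷ L ≫ (α_ L R L).hom) ≫ L ◁ adj.counit = (λ_ L).hom ≫ (ρ_ L).inv := by
    rw [← adj.left_triangle]; bicategory
  exact IsIso.of_isIso_fac_left left_triangle

theorem isIso_counit_whiskerRight (adj : L ⊣ R) [IsIso adj.unit] : IsIso (adj.counit ▷ R) := by
  have right_triangle :
      (R ◁ adj.unit ≫ (α_ R L R).inv) ≫ adj.counit ▷ R = (ρ_ R).hom ≫ (λ_ R).inv := by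
    rw [← adj.right_triangle]; bicategory
  exact IsIso.of_isIso_fac_left right_triangle

theorem isIso_whiskerLeft_of_iso {A B C : K} {f f' : A ⟶ B} (e : f ≅ f') {g g' : B ⟶ C}
    (θ : g ⟶ g') [IsIso (f ◁ θ)] : IsIso (f' ◁ θ) :=
  IsIso.of_isIso_fac_left (whisker_exchange e.hom θ).symm

theorem isIso_whiskerRight_of_iso {A B C : K} {f f' : A ⟶ B} (θ : f ⟶ f') {g g' : B ⟶ C}
    (e : g ≅ g') [IsIso (θ ▷ g)] : IsIso (θ ▷ g') :=
  IsIso.of_isIso_fac_left (whisker_exchange θ e.hom)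

theorem exists_adjunction_of_counit_factorization (u : 𝟙 A ≅ L ≫ R) {D : K} {X : B ⟶ D}
    {Y : D ⟶ B} {m : D ⟶ D} (κ : m ⟶ 𝟙 D) (c : R ≫ L ≅ X ≫ m ≫ Y) (d : X ≫ Y ≅ 𝟙 B)
    [IsIso ((L ≫ X) ◁ κ)] [IsIso (κ ▷ (Y ≫ R))] : ∃ adj : L ⊣ R, adj.unit = u.hom := by
  let v : R ≫ L ⟶ 𝟙 B := c.hom ≫ X ◁ κ ▷ Y ⊗≫ d.hom
  have : leftZigzag u.hom v = u.hom ▷ L ⊗≫ L ◁ c.hom ⊗≫ ((L ≫ X) ◁ κ) ▷ Y ⊗≫ L ◁ d.hom := by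
    bicategory
  have : IsIso (leftZigzag u.hom v) := by
    rw [this]; unfold bicategoricalComp; infer_instance
  have : rightZigzag u.hom v = R ◁ u.hom ⊗≫ c.hom ▷ R ⊗≫ X ◁ κ ▷ (Y ≫ R) ⊗≫ d.hom ▷ R := by
    bicategory
  have : IsIso (rightZigzag u.hom v) := by
    rw [this]; unfold bicategoricalComp; infer_instance
  exact exists_adjunction_of_isIso_zigzag u.hom v

end Unit

namespace TwoMonad

theorem exists_adjunction_unit_eq (M : TwoMonad K) {A : K}
    (adj : M.η (M.T.obj A) ⊣ M.μ A) {a : M.T.obj A ⟶ A} (a₀ : 𝟙 A ≅ M.η A ≫ a)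
    (a₂ : M.T.map a ≫ a ≅ M.μ A ≫ a) : ∃ adj : M.η A ⊣ a, adj.unit = a₀.hom := by
  have := isIso_unit_of_iso adj (eqToIso (M.η_T_μ A))
  have := isIso_whiskerLeft_counit adj
  have := isIso_counit_whiskerRight adj
  have : IsIso ((M.η A ≫ M.η (M.T.obj A)) ◁ adj.counit) := by
    rw [comp_whiskerLeft]; infer_instance
  have := isIso_whiskerLeft_of_iso (eqToIso (M.η_naturality (M.η A))) adj.counit
  have : IsIso (adj.counit ▷ (M.μ A ≫ a)) := by
    rw [whiskerRight_comp]; infer_instance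
  have := isIso_whiskerRight_of_iso adj.counit a₂.symm
  -- The counit is modelled on `a ≫ η = η ≫ T a = (T η ≫ μ) ≫ η ≫ T a ⟶ T η ≫ T a ≅ 𝟙`.
  exact exists_adjunction_of_counit_factorization a₀ adj.counit
    (eqToIso (M.η_naturality a) ≪≫ (λ_ _).symm ≪≫
      whiskerRightIso (eqToIso (M.T_η_μ A).symm) _ ≪≫ α_ _ _ _ ≪≫
      whiskerLeftIso _ (α_ _ _ _).symm)
    ((M.T.mapComp (M.η A) a).symm ≪≫ M.T.map₂Iso a₀.symm ≪≫ M.T.mapId A)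

end TwoMonad

end AlgKan

theorem proposition4p12_general {K : Type u} [Bicategory.{w, v} K]
    (hK : AlgKan.HasCommaObjects K) (M : AlgKan.TwoMonad K)
    (hM : ∀ A : K, Nonempty (M.η (M.T.obj A) ⊣ M.μ A)) {A B : K}
    {a : M.T.obj A ⟶ A} (a₀ : 𝟙 A ≅ M.η A ≫ a) (a₂ : M.T.map a ≫ a ≅ M.μ A ≫ a)
    {b : M.T.obj B ⟶ B} (b₀ : 𝟙 B ≅ M.η B ≫ b) (b₂ : M.T.map b ≫ b ≅ M.μ B ≫ b)
    {f : A ⟶ B} {φ : a ≫ f ⟶ M.T.map f ≫ b}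
    (hφ : 𝟙 f ⊗≫ a₀.hom ▷ f ⊗≫ M.η A ◁ φ =
      𝟙 f ⊗≫ f ◁ b₀.hom ⊗≫ eqToHom (M.η_naturality f) ▷ b ⊗≫ 𝟙 (M.η A ≫ M.T.map f ≫ b)) :
    AlgKan.IsExactSquare f b a (M.T.map f) φ := by
  obtain ⟨adjA, hA⟩ := M.exists_adjunction_unit_eq (hM A).some a₀ a₂
  obtain ⟨adjB, hB⟩ := M.exists_adjunction_unit_eq (hM B).some b₀ b₂
  rw [← hA, ← hB] at hφ
  rw [AlgKan.eq_mateEquiv_of_unit_comp adjA adjB (eqToHom (M.η_naturality f)) φ hφ]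
  exact AlgKan.isExactSquare_mateEquiv hK adjA adjB (eqToIso (M.η_naturality f))

theorem proposition4p12 {K : Type u} [Bicategory.{w, v} K] [Bicategory.Strict K]
    (hK : AlgKan.HasCommaObjects K) (M : AlgKan.TwoMonad K) (hM : M.IsColaxIdempotent)
    (X Y : AlgKan.TwoMonad.PseudoAlgebra M) (F : AlgKan.TwoMonad.ColaxMorphism X Y) :
    F.IsExact := by
  obtain ⟨adj, -⟩ := hM
  exact proposition4p12_general hK M (fun A => ⟨adj A⟩) X.a₀ X.a₂ Y.a₀ Y.a₂ F.unit
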